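/- Let $\mathcal{A}$ be a (skeletally small) abelian length category, that is, an abelian category in which every object has a composition series. A torsion class is a full subcategory of $\mathcal{A}$, closed under isomorphisms and containing $0$, that is closed under quotients and extensions; a wide subcategory is a full subcategory, closed under isomorphisms and containing $0$, that is closed under kernels, cokernels and extensions. Let $\mathsf{tors}\,\mathcal{A}$ be the complete lattice of torsion classes and $\mathsf{wide}\,\mathcal{A}$ the poset of wide subcategories, both ordered by inclusion, and for $\mathcal{W}\in\mathsf{wide}\,\mathcal{A}$ let $\mathsf{T}(\mathcal{W})$ be the smallest torsion class containing $\mathcal{W}$. For $L=\mathsf{tors}\,\mathcal{A}$ use the following notation. An element $j\in L$ is completely join-irreducible if $j=\bigvee X$ with $X\subseteq L$ implies $j\in X$; put $j_*=\bigvee\{x\in L\mid x<j\}$ and $\kappa(j)=\max\{x\in L\mid j\wedge x=j_*\}$ (for completely join-irreducible $j$ this maximum exists). For $a\le b$ in $L$ let $\mathrm{jlabel}[a,b]$ be the set of completely join-irreducible $j\in L$ with $j\le b$ and $\kappa(j)\ge a$. A canonical join representation of $x\in L$ is an expression $x=\bigvee A$, where $A\subseteq L$ is an antichain such that whenever $x=\bigvee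 B$ with $B\subseteq L$, each $a\in A$ satisfies $a\le b$ for some $b\in B$. Let $L_0$ be the set of $x\in L$ that have a canonical join representation. For $x\in L$ put $x_\downarrow=x\wedge\bigwedge\{x'\in L\mid x' \text{ is covered by } x\}$, and for $x,y\in L_0$ write $x\le_{\mathrm{clo}}y$ if $\mathrm{jlabel}[x_\downarrow,x]\subseteq\mathrm{jlabel}[y_\downarrow,y]$. Write $(\mathsf{tors}\,\mathcal{A})_{\mathrm{clo}}=(L_0,\le_{\mathrm{clo}})$. Then the map $\mathsf{T}\colon\mathsf{wide}\,\mathcal{A}\to\mathsf{tors}\,\mathcal{A}$ induces a poset isomorphism $\mathsf{wide}\,\mathcal{A}\xrightarrow{\ \sim\ }(\mathsf{tors}\,\mathcal{A})_{\mathrm{clo}}$: it takes values in $L_0$, is a bijection onto $L_0$, and $\mathcal{W}_1\subseteq\mathcal{W}_2$ if and only if $\mathsf{T}(\mathcal{W}_1)\le_{\mathrm{clo}}\mathsf{T}(\mathcal{W}_2)$. -/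

import Mathlib

open CategoryTheory CategoryTheory.Limits

universe v u

section LatticeTheory

variable {L : Type*} [CompleteLattice L]

/-- `j` is completely join-irreducible: `j = ⋁ X` implies `j ∈ X`. -/
def IsCompletelyJoinIrred (j : L) : Prop :=
  ∀ X : Set L, j = sSup X → j ∈ X

/-- `a_* = ⋁ {x | x < a}`. -/
def lowerStar (a : L) : L := sSup {x | x < a}

/-- The kappa map `κ(j) = max {x | j ⊓ x = j_*}`. It is written as a supremum so as to be total;
whether it is a maximum is the content of `IsGreatest {x | j ⊓ x = lowerStar j} (kappa j)`. -/
def kappa (j : L) : L := sSup {x | j ⊓ x = lowerStar j}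

/-- `jlabel [a, b]`, the set of completely join-irreducible `j` with `j ≤ b` and `κ(j) ≥ a`. -/
def jlabel (a b : L) : Set L :=
  {j | IsCompletelyJoinIrred j ∧ j ≤ b ∧ a ≤ kappa j}

/-- `x = ⋁ A` is the canonical join representation of `x`: it refines every join representation
of `x`, and `A` is an antichain. -/
structure IsCanonicalJoinRep (A : Set L) (x : L) : Prop where
  sSup_eq : sSup A = x
  refines : ∀ B : Set L, sSup B = x → ∀ a ∈ A, ∃ b ∈ B, a ≤ b
  antichain : ∀ a₁ ∈ A, ∀ a₂ ∈ A, a₁ ≤ a₂ → a₁ = a₂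

variable (L) in
/-- `L₀`, the set of elements of `L` that have a canonical join representation. -/
def CJRElements : Type _ := {x : L // ∃ A : Set L, IsCanonicalJoinRep A x}

/-- `x_↓`, the meet of `x` and all elements covered by `x`. -/
def lowerCore (x : L) : L := x ⊓ sInf {x' | x' ⋖ x}

/-- The core label order on `L₀`: `jlabel [x_↓, x] ⊆ jlabel [y_↓, y]`. -/
def cloLE (x y : CJRElements L) : Prop :=
  jlabel (lowerCore x.1) x.1 ⊆ jlabel (lowerCore y.1) y.1

end LatticeTheory

section AbelianCategories

open scoped ZeroObject

variable (C : Type u) [Category.{v} C] [Abelian C]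

variable {C} in
/-- `X` has a composition series `0 = X₀ ⊆ X₁ ⊆ ⋯ ⊆ Xₙ = X` with all `Xᵢ / Xᵢ₋₁` simple
(the series is built up from the bottom, one short exact sequence for each step). -/
inductive HasCompositionSeries : C → Prop
  | zero (X : C) (hX : IsZero X) : HasCompositionSeries X
  | step (S : ShortComplex C) (hS : S.ShortExact) (h₁ : HasCompositionSeries S.X₁)
      (h₃ : Simple S.X₃) : HasCompositionSeries S.X₂

/-- A torsion class: a full subcategory, closed under isomorphisms, that contains zero and is
closed under quotients and extensions (closure under isomorphisms is part of closure under
quotients, as isomorphisms are epimorphisms). -/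
structure TorsionClass where
  obj : ObjectProperty C
  containsZero : obj.ContainsZero
  closedUnderQuotients : obj.IsClosedUnderQuotients
  closedUnderExtensions : obj.IsClosedUnderExtensions

/-- A wide subcategory: a full subcategory, closed under isomorphisms, that contains zero and is
closed under kernels, cokernels and extensions. -/
structure WideSubcat where
  obj : ObjectProperty C
  closedUnderIsomorphisms : obj.IsClosedUnderIsomorphisms
  containsZero : obj.ContainsZero
  closedUnderKernels : obj.IsClosedUnderKernels
  closedUnderCokernels : obj.IsClosedUnderCokernels
  closedUnderExtensions : obj.IsClosedUnderExtensions

variable {C}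

theorem TorsionClass.obj_injective :
    Function.Injective (TorsionClass.obj : TorsionClass C → ObjectProperty C) := by
  rintro ⟨P, _, _, _⟩ ⟨Q, _, _, _⟩ h
  cases h
  rfl

theorem WideSubcat.obj_injective :
    Function.Injective (WideSubcat.obj : WideSubcat C → ObjectProperty C) := by
  rintro ⟨P, _, _, _, _, _⟩ ⟨Q, _, _, _, _, _⟩ h
  cases h
  rfl

/-- Torsion classes are ordered by inclusion. -/
instance : PartialOrder (TorsionClass C) :=
  PartialOrder.lift TorsionClass.obj TorsionClass.obj_injective

/-- Wide subcategories are ordered by inclusion. -/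
instance : PartialOrder (WideSubcat C) :=
  PartialOrder.lift WideSubcat.obj WideSubcat.obj_injective

/-- The infimum of a set of torsion classes is their intersection. -/
instance : InfSet (TorsionClass C) where
  sInf 𝒳 :=
    { obj := fun X => ∀ T ∈ 𝒳, T.obj X
      containsZero := ⟨0, isZero_zero C, fun T _ => by
        have := T.containsZero
        have := T.closedUnderQuotients
        exact T.obj.prop_zero⟩
      closedUnderQuotients := ⟨fun f _ hX T hT =>
        T.closedUnderQuotients.prop_of_epi f (hX T hT)⟩
      closedUnderExtensions := ⟨fun hS h₁ h₃ T hT =>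
        T.closedUnderExtensions.prop_X₂_of_shortExact hS (h₁ T hT) (h₃ T hT)⟩ }

theorem TorsionClass.isGLB_sInf (𝒳 : Set (TorsionClass C)) : IsGLB 𝒳 (sInf 𝒳) :=
  ⟨fun _ hT _ hX => hX _ hT, fun _ hU _ hX _ hT => hU hT _ hX⟩

/-- The complete lattice of torsion classes. -/
instance : CompleteLattice (TorsionClass C) :=
  completeLatticeOfInf (TorsionClass C) TorsionClass.isGLB_sInf

/-- `T(P)`, the smallest torsion class containing `P`. -/
def torsionClosure (P : ObjectProperty C) : TorsionClass C :=
  sInf {T | P ≤ T.obj}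

end AbelianCategories

/-! A wide subcategory `W` is filtered by its simple objects, which form a semibrick `S` by Schur's
lemma, so `T(W) = T(S)`. Semibricks match canonical join representations: `T(S)` is canonically the
join of the `gen B` with `B ∈ S`. Conversely, members of such a representation are completely
join-irreducible, hence of the form `gen B` with `B` a brick, and these bricks are Hom-orthogonal.

The inverse map sends `T` to `T.kernelClosed`. It recovers `W` from `T(W)` (`wide_torsionClosure`),
and it contains `S` when `T = T(S)`, so it generates `T(S)` again.

For the order, `κ(gen B) = perp B`, and the lower covers of `T(S)` are the `T(S) ⊓ perp B`, so
`T(S)_↓` consists of the objects of `T(S)` with no nonzero map to `S`. Hence `Y ∈ W` exactly when `Y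
∈ T(W)` and `T(W)_↓ ≤ perp Y` (`mem_iff_lowerCore_le_perp`). The labels of `[T(W)_↓, T(W)]` are thus
the `gen B` for bricks `B ∈ W`, and these determine `W`. -/

/-! ### Lengths of objects, as induction parameter -/

section Length

variable {C : Type u} [Category.{v} C] [Abelian C]

/-- Every chain of subobjects of `X` has at most `n` proper inclusions. -/
def SubobjectHeightLE : ℕ → C → Prop
  | 0, X => IsZero X
  | n + 1, X => ∀ ⦃Y : C⦄ (i : Y ⟶ X) [Mono i], ¬IsIso i → SubobjectHeightLE n Y

namespace SubobjectHeightLE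

theorem of_mono {n : ℕ} {X Y : C} (h : SubobjectHeightLE n X) (i : Y ⟶ X) [Mono i] :
    SubobjectHeightLE n Y := by
  cases n with
  | zero => exact IsZero.of_mono i h
  | succ n =>
    intro Z j _ hj
    refine h (j ≫ i) fun hji => hj ?_
    have : Epi i := epi_of_epi j i
    have : IsIso i := isIso_of_mono_of_epi i
    exact IsIso.of_isIso_comp_right j i

/-- A proper subobject of `X₂` either lies in `X₁` or maps onto the simple `X₃`; in the latter case
it meets `X₁` properly, and induction applies to it. -/
theorem extension_simple (n : ℕ) : ∀ {S : ShortComplex C}, S.ShortExact → Simple S.X₃ →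
    SubobjectHeightLE n S.X₁ → SubobjectHeightLE (n + 1) S.X₂ := by
  induction n with
  | zero =>
    intro S hS h₃ h₁ Y i _ hi
    have := hS.mono_f
    have := hS.epi_g
    have hg : IsIso S.g := by
      have := hS.exact.mono_g (h₁.eq_of_src _ _)
      exact isIso_of_mono_of_epi _
    by_contra hY
    have hig : i ≫ S.g ≠ 0 := fun h0 => hY ((IsZero.iff_id_eq_zero Y).2 <| by
      rw [← cancel_mono (i ≫ S.g), h0, comp_zero, comp_zero])
    have := isIso_of_mono_of_nonzero hig
    exact hi (IsIso.of_isIso_comp_right i S.g)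
  | succ n ih =>
    intro S hS h₃ h₁ Y i _ hi
    have := hS.mono_f
    have := hS.epi_g
    by_cases h0 : i ≫ S.g = 0
    · have : Mono (hS.exact.lift i h0) :=
        mono_of_mono_fac (hS.exact.lift_f i h0)
      exact h₁.of_mono (hS.exact.lift i h0)
    · have : Epi (i ≫ S.g) := epi_of_nonzero_to_simple h0
      have hk0 : (kernel.ι (i ≫ S.g) ≫ i) ≫ S.g = 0 := by simp
      have hk := hS.exact.lift_f _ hk0
      have : Mono (hS.exact.lift _ hk0) := mono_of_mono_fac hk
      have hK : SubobjectHeightLE n (kernel (i ≫ S.g)) := by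
        refine h₁ (hS.exact.lift _ hk0) fun hiso => hi ?_
        have : Epi i := Preadditive.epi_of_cancel_zero _ fun {Z} w hw => by
          have hfw : S.f ≫ w = 0 := by
            rw [← cancel_epi (hS.exact.lift _ hk0), ← Category.assoc, hk, Category.assoc, hw]
            simp
          have hd := hS.exact.g_desc w hfw
          have : (i ≫ S.g) ≫ hS.exact.desc w hfw = 0 := by rw [Category.assoc, hd, hw]
          rw [← hd, (Preadditive.epi_iff_cancel_zero (i ≫ S.g)).1 inferInstance _ _ this,
            comp_zero]
        exact isIso_of_mono_of_epi i
      have hex : (ShortComplex.mk (kernel.ι (i ≫ S.g)) (i ≫ S.g)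
          (kernel.condition _)).ShortExact :=
        { exact := ShortComplex.exact_kernel _ }
      exact ih hex h₃ hK

/-- Preimages of proper subobjects are proper, and the restriction of `p` to a preimage has the same
kernel as `p`. -/
theorem of_epi (n : ℕ) : ∀ {X Q : C} (p : X ⟶ Q) [Epi p], ¬IsIso p →
    SubobjectHeightLE (n + 1) X → SubobjectHeightLE n Q := by
  induction n with
  | zero =>
    intro X Q p _ hp h
    by_cases hk : IsIso (kernel.ι p)
    · have : p = 0 := by
        rw [← cancel_epi (kernel.ι p), kernel.condition, comp_zero]
      exact IsZero.of_epi_eq_zero p this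
    · have hz : IsZero (kernel p) := h (kernel.ι p) hk
      have : Mono p := Preadditive.mono_of_kernel_zero (hz.eq_of_src _ _)
      exact absurd (isIso_of_mono_of_epi p) hp
  | succ n ih =>
    intro X Q p _ hp h Q' j _ hj
    have hY : SubobjectHeightLE (n + 1) (pullback p j) := by
      refine h (pullback.fst p j) fun hiso => hj ?_
      have : Epi (pullback.snd p j ≫ j) := by
        rw [← pullback.condition]; infer_instance
      have : Epi j := epi_of_epi (pullback.snd p j) j
      exact isIso_of_mono_of_epi j
    refine ih (pullback.snd p j) (fun hiso => hp ?_) hY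
    have : Mono p := Preadditive.mono_of_cancel_zero _ fun {Z} w hw => by
      have hc : w ≫ p = (0 : Z ⟶ Q') ≫ j := by rw [hw, zero_comp]
      have h2 : pullback.lift w 0 hc = 0 := by
        rw [← cancel_mono (pullback.snd p j), pullback.lift_snd, zero_comp]
      rw [← pullback.lift_fst w 0 hc, h2, zero_comp]
    exact isIso_of_mono_of_epi p

end SubobjectHeightLE

theorem HasCompositionSeries.exists_subobjectHeightLE {X : C} (h : HasCompositionSeries X) :
    ∃ n, SubobjectHeightLE n X := by
  induction h with
  | zero X hX => exact ⟨0, hX⟩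
  | step S hS _ h₃ ih =>
    obtain ⟨n, hn⟩ := ih
    exact ⟨n + 1, SubobjectHeightLE.extension_simple n hS h₃ hn⟩

variable (C) in
/-- Every object has a composition series. -/
class IsLengthCategory : Prop where
  hasCompositionSeries (X : C) : HasCompositionSeries X

variable [IsLengthCategory C]

theorem exists_subobjectHeightLE (X : C) : ∃ n, SubobjectHeightLE n X :=
  (IsLengthCategory.hasCompositionSeries X).exists_subobjectHeightLE

open Classical in
/-- The maximal length of a chain of subobjects of `X`. -/
noncomputable def objLength (X : C) : ℕ := Nat.find (exists_subobjectHeightLE X)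

theorem subobjectHeightLE_objLength (X : C) : SubobjectHeightLE (objLength X) X := by
  classical exact Nat.find_spec (exists_subobjectHeightLE X)

theorem objLength_le {n : ℕ} {X : C} (h : SubobjectHeightLE n X) : objLength X ≤ n := by
  classical exact Nat.find_min' _ h

theorem objLength_lt_of_mono {X Y : C} (i : Y ⟶ X) [Mono i] (hi : ¬IsIso i) :
    objLength Y < objLength X := by
  have h := subobjectHeightLE_objLength X
  cases hn : objLength X with
  | zero =>
    rw [hn] at h
    have hX : IsZero X := h
    have : Epi i := ⟨fun _ _ _ => hX.eq_of_src _ _⟩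
    exact absurd (isIso_of_mono_of_epi i) hi
  | succ n =>
    rw [hn] at h
    exact Nat.lt_succ_of_le (objLength_le (h i hi))

theorem objLength_lt_of_epi {X Q : C} (p : X ⟶ Q) [Epi p] (hp : ¬IsIso p) :
    objLength Q < objLength X := by
  have h := subobjectHeightLE_objLength X
  cases hn : objLength X with
  | zero =>
    rw [hn] at h
    have hX : IsZero X := h
    have : Mono p := ⟨fun _ _ _ => hX.eq_of_tgt _ _⟩
    exact absurd (isIso_of_mono_of_epi p) hp
  | succ n =>
    rw [hn] at h
    exact Nat.lt_succ_of_le (objLength_le (SubobjectHeightLE.of_epi n p hp h))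

theorem isIso_of_epi_endo {X : C} (f : X ⟶ X) [Epi f] : IsIso f := by
  by_contra h
  exact lt_irrefl _ (objLength_lt_of_epi f h)

theorem objLength_cokernel_lt {X Y : C} (f : X ⟶ Y) (hf : f ≠ 0) :
    objLength (cokernel f) < objLength Y := by
  refine objLength_lt_of_epi (cokernel.π f) fun h => hf ?_
  rw [← cancel_mono (cokernel.π f), cokernel.condition, zero_comp]

theorem objLength_kernel_lt {X Y : C} (f : X ⟶ Y) (hf : f ≠ 0) :
    objLength (kernel f) < objLength X := by
  refine objLength_lt_of_mono (kernel.ι f) fun h => hf ?_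
  rw [← cancel_epi (kernel.ι f), kernel.condition, comp_zero]

end Length

/-! ### Torsion classes, bricks and completely join-irreducible elements -/

section Torsion

variable {C : Type u} [Category.{v} C] [Abelian C]

namespace CategoryTheory.ObjectProperty

variable (P : ObjectProperty C) [P.IsClosedUnderExtensions]

theorem prop_of_epi_of_kernel {X Q : C} (p : X ⟶ Q) [Epi p] (hK : P (kernel p)) (hQ : P Q) :
    P X :=
  P.prop_X₂_of_shortExact (S := ShortComplex.mk (kernel.ι p) p (kernel.condition p))
    { exact := ShortComplex.exact_kernel p } hK hQ

theorem prop_of_mono_of_cokernel {A X : C} (i : A ⟶ X) [Mono i] (hA : P A)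
    (hX : P (cokernel i)) : P X :=
  P.prop_X₂_of_shortExact (S := ShortComplex.mk i (cokernel.π i) (cokernel.condition i))
    { exact := ShortComplex.exact_cokernel i } hA hX

/-- There is a short exact sequence `0 → ker p → ker (p ≫ q) → ker q → 0`. -/
theorem prop_kernel_comp {X Y Z : C} (p : X ⟶ Y) [Epi p] (q : Y ⟶ Z)
    (hp : P (kernel p)) (hq : P (kernel q)) : P (kernel (p ≫ q)) := by
  let φ : kernel (p ≫ q) ⟶ kernel q := kernel.lift q (kernel.ι (p ≫ q) ≫ p) (by simp)
  let ψ : kernel p ⟶ kernel (p ≫ q) := kernel.lift (p ≫ q) (kernel.ι p) (by simp)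
  have hφ : φ ≫ kernel.ι q = kernel.ι (p ≫ q) ≫ p := kernel.lift_ι _ _ _
  have hψ : ψ ≫ kernel.ι (p ≫ q) = kernel.ι p := kernel.lift_ι _ _ _
  have hz : ψ ≫ φ = 0 := by
    rw [← cancel_mono (kernel.ι q), Category.assoc, hφ, ← Category.assoc, hψ]
    simp
  have : Mono ψ := mono_of_mono_fac hψ
  have : Epi φ := by
    rw [epi_iff_surjective_up_to_refinements]
    intro A y
    obtain ⟨A', π, hπ, x, hx⟩ := surjective_up_to_refinements_of_epi p (y ≫ kernel.ι q)
    refine ⟨A', π, hπ, kernel.lift (p ≫ q) x ?_, ?_⟩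
    · rw [← Category.assoc, ← hx]; simp
    · rw [← cancel_mono (kernel.ι q), Category.assoc, Category.assoc, hφ, kernel.lift_ι_assoc, hx]
  have hex : (ShortComplex.mk ψ φ hz).Exact := by
    rw [ShortComplex.exact_iff_exact_up_to_refinements]
    intro A x hx
    refine ⟨A, 𝟙 A, inferInstance, kernel.lift p (x ≫ kernel.ι (p ≫ q)) ?_, ?_⟩
    · rw [Category.assoc, ← hφ, reassoc_of% hx, zero_comp]
    · rw [← cancel_mono (kernel.ι (p ≫ q))]
      simp [hψ]
  exact P.prop_X₂_of_shortExact (S := ShortComplex.mk ψ φ hz) { exact := hex } hp hq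

end CategoryTheory.ObjectProperty

namespace TorsionClass

instance (T : TorsionClass C) : T.obj.ContainsZero := T.containsZero
instance (T : TorsionClass C) : T.obj.IsClosedUnderQuotients := T.closedUnderQuotients
instance (T : TorsionClass C) : T.obj.IsClosedUnderExtensions := T.closedUnderExtensions

theorem image_mem (T : TorsionClass C) {X Y : C} (f : X ⟶ Y) (hX : T.obj X) :
    T.obj (Abelian.image f) :=
  T.obj.prop_of_epi (Abelian.factorThruImage f) hX

/-- The torsion class of all objects without nonzero morphisms to `Y`. -/
def perp (Y : C) : TorsionClass C where
  obj := fun X => ∀ f : X ⟶ Y, f = 0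
  containsZero := ⟨_, isZero_zero C, fun _ => (isZero_zero C).eq_of_src _ _⟩
  closedUnderQuotients := ⟨fun p _ h f => by rw [← cancel_epi p, h (p ≫ f), comp_zero]⟩
  closedUnderExtensions := ⟨fun {S} hS h₁ h₃ f => by
    have := hS.epi_g
    rw [← hS.exact.g_desc f (h₁ _), h₃ (hS.exact.desc f (h₁ _)), comp_zero]⟩

/-- Images of nonzero maps from `T` are divided out until none is left; each step lowers the length.
-/
theorem exists_torsionFree_quotient [IsLengthCategory C] (T : TorsionClass C) (X : C) :
    ∃ (Y : C) (p : X ⟶ Y), Epi p ∧ T.obj (kernel p) ∧ T ≤ perp Y := by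
  induction h : objLength X using Nat.strong_induction_on generalizing X with
  | _ n ih =>
    by_cases hX : T ≤ perp X
    · refine ⟨X, 𝟙 X, inferInstance, ?_, hX⟩
      exact T.obj.prop_of_isZero (isZero_kernel_of_mono _)
    · obtain ⟨Z, hZ, f, hf⟩ : ∃ Z, T.obj Z ∧ ∃ f : Z ⟶ X, f ≠ 0 := by
        by_contra! h
        exact hX h
      obtain ⟨Y, q, _, hq, hY⟩ := ih _ (h ▸ objLength_cokernel_lt f hf) (cokernel f) rfl
      exact ⟨Y, cokernel.π f ≫ q, inferInstance,
        T.obj.prop_kernel_comp _ _ (T.image_mem f hZ) hq, hY⟩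

theorem le_of_forall_perp [IsLengthCategory C] {T U : TorsionClass C}
    (h : ∀ Y, U ≤ perp Y → T ≤ perp Y) : T ≤ U := by
  intro X hX
  obtain ⟨Y, p, _, hK, hY⟩ := U.exists_torsionFree_quotient X
  exact U.obj.prop_of_epi_of_kernel p hK
    (U.obj.prop_of_isZero (IsZero.of_epi_eq_zero p (h Y hY X hX p)))

theorem exists_mem_of_not_le_perp {T : TorsionClass C} {Y : C} (h : ¬T ≤ perp Y) :
    ∃ (X : C) (f : X ⟶ Y), T.obj X ∧ f ≠ 0 := by
  by_contra! h'
  exact h fun X hX f => h' X f hX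

theorem not_le_perp {T : TorsionClass C} {X Y : C} (hX : T.obj X) {f : X ⟶ Y} (hf : f ≠ 0) :
    ¬T ≤ perp Y :=
  fun h => hf (h X hX f)

theorem mem_inf {T U : TorsionClass C} {X : C} : (T ⊓ U).obj X ↔ T.obj X ∧ U.obj X := by
  refine ⟨fun h => ⟨(inf_le_left : T ⊓ U ≤ T) X h, (inf_le_right : T ⊓ U ≤ U) X h⟩, fun h => ?_⟩
  have : sInf {T, U} ≤ T ⊓ U := le_inf (sInf_le (by simp)) (sInf_le (by simp))
  refine this X ?_
  rintro V (rfl | rfl)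
  exacts [h.1, h.2]

theorem mem_sInf {𝒳 : Set (TorsionClass C)} {X : C} : (sInf 𝒳).obj X ↔ ∀ T ∈ 𝒳, T.obj X :=
  Iff.rfl

/-- The torsion class generated by an object. -/
def gen (B : C) : TorsionClass C := torsionClosure (.singleton B)

end TorsionClass

open TorsionClass

theorem torsionClosure_le {P : ObjectProperty C} {T : TorsionClass C} :
    torsionClosure P ≤ T ↔ P ≤ T.obj :=
  ⟨fun h X hX => h X fun _ hU => hU X hX, fun h => sInf_le h⟩

theorem le_torsionClosure (P : ObjectProperty C) : P ≤ (torsionClosure P).obj :=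
  torsionClosure_le.1 le_rfl

theorem torsionClosure_le_perp {P : ObjectProperty C} {Y : C} :
    torsionClosure P ≤ perp Y ↔ ∀ X, P X → ∀ f : X ⟶ Y, f = 0 :=
  torsionClosure_le

/-- Otherwise `perp Y` contains `P`, hence `Y` itself. This replaces an explicit description of
`T(P)` by filtrations. -/
theorem exists_ne_zero_of_mem_torsionClosure {P : ObjectProperty C} {Y : C}
    (hY : (torsionClosure P).obj Y) (h0 : ¬IsZero Y) :
    ∃ (X : C) (f : X ⟶ Y), P X ∧ f ≠ 0 := by
  by_contra! h
  exact h0 ((IsZero.iff_id_eq_zero Y).2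
    (torsionClosure_le_perp.2 (fun X hX f => h X f hX) Y hY (𝟙 Y)))

theorem TorsionClass.gen_le {B : C} {T : TorsionClass C} : gen B ≤ T ↔ T.obj B :=
  torsionClosure_le.trans (ObjectProperty.singleton_le_iff ..)

theorem TorsionClass.mem_gen (B : C) : (gen B).obj B := gen_le.1 le_rfl

/-- Every nonzero endomorphism is invertible. -/
structure IsBrick (B : C) : Prop where
  not_isZero : ¬IsZero B
  isIso (f : B ⟶ B) : f ≠ 0 → IsIso f

/-- A class of nonzero objects such that every nonzero morphism between them is invertible. -/
structure IsSemibrick (S : ObjectProperty C) : Prop where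
  not_isZero (X : C) : S X → ¬IsZero X
  isIso {X Y : C} (f : X ⟶ Y) : S X → S Y → f ≠ 0 → IsIso f

theorem IsSemibrick.isBrick {S : ObjectProperty C} (hS : IsSemibrick S) {B : C} (hB : S B) :
    IsBrick B :=
  ⟨hS.not_isZero B hB, fun f => hS.isIso f hB hB⟩

theorem IsBrick.isSemibrick {B : C} (hB : IsBrick B) :
    IsSemibrick (ObjectProperty.singleton B) := by
  constructor
  · intro X hX
    obtain rfl := (ObjectProperty.singleton_iff ..).1 hX
    exact hB.not_isZero
  · intro X Y f hX hY
    obtain rfl := (ObjectProperty.singleton_iff ..).1 hX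
    obtain rfl := (ObjectProperty.singleton_iff ..).1 hY
    exact hB.isIso f

theorem Abelian.image_not_isZero {X Y : C} {f : X ⟶ Y} (hf : f ≠ 0) :
    ¬IsZero (Abelian.image f) := fun h => hf <| by
  rw [← Abelian.image.fac f, h.eq_of_src (Abelian.image.ι f) 0, comp_zero]

/-- The image of `f` lies in `T(S)`, so it receives a nonzero map from some `B' ∈ S`; the composite
`B' ⟶ B` is invertible, so the image is all of `B`. -/
theorem IsSemibrick.epi_of_ne_zero {S : ObjectProperty C} (hS : IsSemibrick S) {X B : C}
    (hX : (torsionClosure S).obj X) (hB : S B) (f : X ⟶ B) (hf : f ≠ 0) : Epi f := by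
  obtain ⟨B', g, hB', hg⟩ := exists_ne_zero_of_mem_torsionClosure
    ((torsionClosure S).image_mem f hX) (Abelian.image_not_isZero hf)
  have hne : g ≫ Abelian.image.ι f ≠ 0 := fun h => hg <| by
    rw [← cancel_mono (Abelian.image.ι f), h, zero_comp]
  have := hS.isIso _ hB' hB hne
  have : Epi (Abelian.image.ι f) := epi_of_epi g _
  rw [← Abelian.image.fac f]
  infer_instance

/-- A torsion class below `T(S)` that admits a nonzero morphism to `B ∈ S` contains `B`. -/
theorem IsSemibrick.mem_of_not_le_perp {S : ObjectProperty C} (hS : IsSemibrick S) {B : C}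
    (hB : S B) {T : TorsionClass C} (hT : T ≤ torsionClosure S) (h : ¬T ≤ perp B) : T.obj B := by
  obtain ⟨X, f, hX, hf⟩ := exists_mem_of_not_le_perp h
  have := hS.epi_of_ne_zero (hT X hX) hB f hf
  exact T.obj.prop_of_epi f hX

theorem IsBrick.not_mem_perp {B : C} (hB : IsBrick B) : ¬(perp B).obj B :=
  fun h => hB.not_isZero ((IsZero.iff_id_eq_zero B).2 (h _))

theorem IsBrick.lt_gen_iff {B : C} (hB : IsBrick B) {T : TorsionClass C} :
    T < gen B ↔ T ≤ gen B ⊓ perp B := by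
  constructor
  · intro h
    refine le_inf h.le ?_
    by_contra hT
    exact h.not_ge (gen_le.2 (hB.isSemibrick.mem_of_not_le_perp
      ((ObjectProperty.singleton_iff ..).2 rfl) h.le hT))
  · intro h
    refine lt_of_le_not_ge (h.trans inf_le_left) fun h' => ?_
    exact hB.not_mem_perp (gen_le.1 (h'.trans (h.trans inf_le_right)))

theorem IsBrick.lowerStar_gen {B : C} (hB : IsBrick B) : lowerStar (gen B) = gen B ⊓ perp B :=
  le_antisymm (sSup_le fun _ hT => hB.lt_gen_iff.1 hT) (le_sSup (hB.lt_gen_iff.2 le_rfl))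

theorem IsBrick.isCompletelyJoinIrred_gen {B : C} (hB : IsBrick B) :
    IsCompletelyJoinIrred (gen B) := by
  intro 𝒳 h
  by_contra hn
  have hle : gen B ≤ gen B ⊓ perp B := by
    conv_lhs => rw [h]
    refine sSup_le fun T hT => hB.lt_gen_iff.1 (lt_of_le_of_ne (h ▸ le_sSup hT) ?_)
    rintro rfl
    exact hn hT
  exact hB.not_mem_perp (gen_le.1 (hle.trans inf_le_right))

/-- A torsion class that contains `(gen B)_*` and admits a nonzero morphism to the brick `B`
contains `B`. -/
theorem IsBrick.mem_of_lowerStar_le {B : C} (hB : IsBrick B) {T : TorsionClass C}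
    (hT : lowerStar (gen B) ≤ T) {U : TorsionClass C} (hUT : U ≤ T) (hU : ¬U ≤ perp B) :
    T.obj B := by
  obtain ⟨X, f, hX, hf⟩ := exists_mem_of_not_le_perp hU
  rw [hB.lowerStar_gen] at hT
  -- A nonzero map `B / im f ⟶ B` would give an invertible endomorphism of `B` that kills `im f`. So
  -- `B / im f` lies in `(gen B)_*`, and `B` is an extension of it by `im f`.
  have hq : T.obj (cokernel (Abelian.image.ι f)) := by
    refine hT _ (mem_inf.2 ⟨(gen B).obj.prop_of_epi (cokernel.π _) (mem_gen B), fun g => ?_⟩)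
    by_contra hg
    have hne : cokernel.π (Abelian.image.ι f) ≫ g ≠ 0 := fun h => hg <| by
      rw [← cancel_epi (cokernel.π (Abelian.image.ι f)), h, comp_zero]
    have := hB.isIso _ hne
    have : Mono (cokernel.π (Abelian.image.ι f)) := mono_of_mono _ g
    refine hf ?_
    rw [← Abelian.image.fac f, (cancel_mono (cokernel.π (Abelian.image.ι f))).1
      ((cokernel.condition _).trans zero_comp.symm), comp_zero]
  exact T.obj.prop_of_mono_of_cokernel _ (T.image_mem f (hUT X hX)) hq

theorem IsBrick.isGreatest_perp {B : C} (hB : IsBrick B) :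
    IsGreatest {x : TorsionClass C | gen B ⊓ x = lowerStar (gen B)} (perp B) := by
  refine ⟨hB.lowerStar_gen.symm, fun T (hT : _ = _) => ?_⟩
  by_contra h
  have hB' := hB.mem_of_lowerStar_le (hT ▸ inf_le_right) le_rfl h
  have : (gen B ⊓ T).obj B := mem_inf.2 ⟨mem_gen B, hB'⟩
  rw [hT, hB.lowerStar_gen] at this
  exact hB.not_mem_perp (mem_inf.1 this).2

theorem IsBrick.kappa_gen {B : C} (hB : IsBrick B) : kappa (gen B) = perp B :=
  hB.isGreatest_perp.isLUB.sSup_eq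

theorem TorsionClass.eq_sSup_gen_brick [IsLengthCategory C] (T : TorsionClass C) :
    T = sSup {U | ∃ B, IsBrick B ∧ T.obj B ∧ U = gen B} := by
  apply le_antisymm
  · refine le_of_forall_perp fun Y hY => ?_
    -- A nonzero subobject of `Y` in `T` of minimal length is a brick: the image of a nonzero
    -- endomorphism is again such a subobject.
    have key : ∀ n, ∀ X : C, objLength X = n → T.obj X → ∀ i : X ⟶ Y, Mono i → IsZero X := by
      intro n
      induction n using Nat.strong_induction_on with
      | _ n ih =>
        intro X hn hX i _
        by_contra h0
        have hb : IsBrick X := by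
          refine ⟨h0, fun f hf => ?_⟩
          have : IsIso (Abelian.image.ι f) := by
            by_contra hi
            exact Abelian.image_not_isZero hf (ih _ (hn ▸ objLength_lt_of_mono _ hi) _ rfl
              (T.image_mem f hX) (Abelian.image.ι f ≫ i) inferInstance)
          have : Epi f := by rw [← Abelian.image.fac f]; infer_instance
          exact isIso_of_epi_endo f
        have hle : gen X ≤ sSup {U | ∃ B, IsBrick B ∧ T.obj B ∧ U = gen B} :=
          le_sSup ⟨X, hb, hX, rfl⟩
        have hi : i = 0 := (hle.trans hY) X (mem_gen X) i
        exact h0 (IsZero.of_mono_eq_zero i hi)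
    intro X hX f
    by_contra hf
    exact Abelian.image_not_isZero hf
      (key _ _ rfl (T.image_mem f hX) (Abelian.image.ι f) inferInstance)
  · refine sSup_le ?_
    rintro _ ⟨B, -, hB, rfl⟩
    exact gen_le.2 hB

theorem IsCompletelyJoinIrred.exists_brick [IsLengthCategory C] {j : TorsionClass C}
    (hj : IsCompletelyJoinIrred j) : ∃ B, IsBrick B ∧ j = gen B := by
  obtain ⟨B, hB, -, h⟩ := hj _ j.eq_sSup_gen_brick
  exact ⟨B, hB, h⟩

end Torsion

/-! ### Wide subcategories and the torsion classes they generate -/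

section Wide

variable {C : Type u} [Category.{v} C] [Abelian C]

open TorsionClass

theorem isIso_kernel_map_fst {X Y Z : C} (f : X ⟶ Z) (g : Y ⟶ Z) :
    IsIso (kernel.map (pullback.fst f g) g (pullback.snd f g) f pullback.condition) :=
  isIso_kernel_map_of_isPullback (IsPullback.of_hasPullback f g)

theorem isIso_kernel_map_snd {X Y Z : C} (f : X ⟶ Z) (g : Y ⟶ Z) :
    IsIso (kernel.map (pullback.snd f g) f (pullback.fst f g) g pullback.condition.symm) :=
  isIso_kernel_map_of_isPullback (IsPullback.of_hasPullback f g).flip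

namespace CategoryTheory.ObjectProperty

variable (P : ObjectProperty C)

theorem prop_kernel_fst_iff [P.IsClosedUnderIsomorphisms] {X Y Z : C} (f : X ⟶ Z) (g : Y ⟶ Z) :
    P (kernel (pullback.fst f g)) ↔ P (kernel g) :=
  have := isIso_kernel_map_fst f g
  P.prop_iff_of_iso (asIso (kernel.map (pullback.fst f g) g (pullback.snd f g) f
    pullback.condition))

theorem prop_kernel_snd_iff [P.IsClosedUnderIsomorphisms] {X Y Z : C} (f : X ⟶ Z) (g : Y ⟶ Z) :
    P (kernel (pullback.snd f g)) ↔ P (kernel f) :=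
  have := isIso_kernel_map_snd f g
  P.prop_iff_of_iso (asIso (kernel.map (pullback.snd f g) f (pullback.fst f g) g
    pullback.condition.symm))

theorem prop_kernel_comp_mono_iff [P.IsClosedUnderIsomorphisms] {X Y Z : C} (f : X ⟶ Y)
    (g : Y ⟶ Z) [Mono g] {h : X ⟶ Z} (w : f ≫ g = h) : P (kernel h) ↔ P (kernel f) := by
  subst w
  exact P.prop_iff_of_iso (kernelCompMono f g)

end CategoryTheory.ObjectProperty

/-- The objects `X` of `T` such that every morphism from an object of `T` to `X` has its kernel
in `T`. -/
def TorsionClass.kernelClosed (T : TorsionClass C) : ObjectProperty C :=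
  fun X => T.obj X ∧ ∀ ⦃Y : C⦄ (f : Y ⟶ X), T.obj Y → T.obj (kernel f)

theorem TorsionClass.kernelClosed_le (T : TorsionClass C) : T.kernelClosed ≤ T.obj :=
  fun _ h => h.1

instance (T : TorsionClass C) : T.kernelClosed.IsClosedUnderIsomorphisms where
  of_iso e h := ⟨T.obj.prop_of_iso e h.1, fun _ f hY =>
    (T.obj.prop_kernel_comp_mono_iff f e.inv rfl).1 (h.2 _ hY)⟩

/-- The wide subcategory associated with a torsion class. -/
def TorsionClass.wide (T : TorsionClass C) : WideSubcat C where
  obj := T.kernelClosed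
  closedUnderIsomorphisms := inferInstance
  containsZero := ⟨_, isZero_zero C, T.obj.prop_of_isZero (isZero_zero C), fun _ f hY => by
    obtain rfl : f = 0 := (isZero_zero C).eq_of_tgt _ _
    exact T.obj.prop_of_iso kernelZeroIsoSource.symm hY⟩
  closedUnderKernels := ⟨by
    rintro _ ⟨f, k, hk, hX, hY⟩
    refine T.kernelClosed.prop_of_iso (hk.conePointUniqueUpToIso (kernelIsKernel f)).symm
      ⟨hY.2 f hX.1, fun Z g hZ => ?_⟩
    exact (T.obj.prop_kernel_comp_mono_iff g (kernel.ι f) rfl).1 (hX.2 _ hZ)⟩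
  closedUnderCokernels := ⟨by
    rintro _ ⟨f, k, hk, hX, hY⟩
    refine T.kernelClosed.prop_of_iso
      ((cokernelIsCokernel f).coconePointUniqueUpToIso hk)
      ⟨T.obj.prop_of_epi (cokernel.π f) hY.1, fun Z g hZ => ?_⟩
    -- The pullback is an extension of `Z` by `im f`, and its projection to the middle object has
    -- kernel `ker g`.
    have hP : T.obj (pullback g (cokernel.π f)) :=
      T.obj.prop_of_epi_of_kernel (pullback.fst g (cokernel.π f))
        ((T.obj.prop_kernel_fst_iff _ _).2 (T.image_mem f hX.1)) hZ
    exact (T.obj.prop_kernel_snd_iff g (cokernel.π f)).1 (hY.2 _ hP)⟩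
  closedUnderExtensions := ⟨by
    intro S hS h₁ h₃
    refine ⟨T.obj.prop_X₂_of_shortExact hS h₁.1 h₃.1, fun Z g hZ => ?_⟩
    have := hS.mono_f
    have hK := h₃.2 (g ≫ S.g) hZ
    have h0 : (kernel.ι (g ≫ S.g) ≫ g) ≫ S.g = 0 := by simp
    have hl := hS.exact.lift_f _ h0
    have hK' := h₁.2 (hS.exact.lift _ h0) hK
    rw [← T.obj.prop_kernel_comp_mono_iff _ S.f hl] at hK'
    refine T.obj.prop_of_iso ?_ hK'
    refine
      { hom := kernel.lift _ (kernel.ι _ ≫ kernel.ι _) (by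
          rw [Category.assoc]; exact kernel.condition _)
        inv := kernel.lift _ (kernel.lift _ (kernel.ι g) (by simp)) (by simp)
        hom_inv_id := ?_
        inv_hom_id := ?_ }
    · rw [← cancel_mono (kernel.ι _), ← cancel_mono (kernel.ι _)]
      simp
    · rw [← cancel_mono (kernel.ι _)]
      simp⟩

/-- To show that `X ∈ T` lies in `T.wide`, it suffices to consider morphisms to `X` with
torsion-free kernel. -/
theorem TorsionClass.kernelClosed_of_mono [IsLengthCategory C] {T : TorsionClass C} {X : C}
    (hX : T.obj X)
    (h : ∀ ⦃Y : C⦄ (f : Y ⟶ X), T.obj Y →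
      (∀ ⦃U : C⦄ (u : U ⟶ Y), T.obj U → u ≫ f = 0 → u = 0) → Mono f) :
    T.kernelClosed X := by
  refine ⟨hX, fun Y f hY => ?_⟩
  -- `Y` is divided by the torsion part of `ker f`. The induced map has torsion-free kernel, so it
  -- is mono, and `ker f` is that torsion part.
  obtain ⟨F, q, _, hq, hF⟩ := T.exists_torsionFree_quotient (kernel f)
  let i : kernel q ⟶ Y := kernel.ι q ≫ kernel.ι f
  have hi : i ≫ f = 0 := by simp [i]
  let f' : cokernel i ⟶ X := cokernel.desc i f hi
  have hf' : cokernel.π i ≫ f' = f := cokernel.π_desc _ _ _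
  have hπ : T.obj (kernel (cokernel.π i)) := T.image_mem i hq
  have : Mono f' := by
    refine h f' (T.obj.prop_of_epi (cokernel.π i) hY) fun U u hU hu => ?_
    have hP : T.obj (pullback u (cokernel.π i)) :=
      T.obj.prop_of_epi_of_kernel (pullback.fst u (cokernel.π i))
        ((T.obj.prop_kernel_fst_iff _ _).2 hπ) hU
    have h0 : pullback.snd u (cokernel.π i) ≫ f = 0 := by
      have h' : pullback.snd u (cokernel.π i) ≫ cokernel.π i ≫ f' =
          pullback.snd u (cokernel.π i) ≫ f := by rw [hf']
      rw [← h', ← Category.assoc, ← pullback.condition, Category.assoc, hu, comp_zero]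
    have h1 : kernel.lift f _ h0 ≫ q = 0 := hF _ hP _
    have h2 : kernel.lift q _ h1 ≫ i = pullback.snd u (cokernel.π i) := by
      simp [i]
    rw [← cancel_epi (pullback.fst u (cokernel.π i)), pullback.condition, ← h2, Category.assoc,
      cokernel.condition, comp_zero, comp_zero]
  exact (T.obj.prop_kernel_comp_mono_iff _ _ hf').2 hπ

/-- If `Y ≠ 0` and `f : Y ⟶ B` has torsion-free kernel, a nonzero `B' ⟶ Y` composes with `f` to an
isomorphism. So `f` splits, and `ker f`, a quotient of `Y`, is torsion and hence zero. -/
theorem IsSemibrick.le_kernelClosed [IsLengthCategory C] {S : ObjectProperty C}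
    (hS : IsSemibrick S) : S ≤ (torsionClosure S).kernelClosed := by
  intro B hB
  refine kernelClosed_of_mono (le_torsionClosure S B hB) fun Y f hY hf => ?_
  by_cases h0 : IsZero Y
  · exact ⟨fun _ _ _ => h0.eq_of_tgt _ _⟩
  obtain ⟨B', h, hB', hne⟩ := exists_ne_zero_of_mem_torsionClosure hY h0
  have hiso := hS.isIso (h ≫ f) hB' hB fun h' => hne (hf h (le_torsionClosure S B' hB') h')
  -- the kernel of `f` is a direct summand of `Y`
  let r : Y ⟶ kernel f := kernel.lift f (𝟙 Y - f ≫ inv (h ≫ f) ≫ h) (by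
    simp [Preadditive.sub_comp])
  have hr : kernel.ι f ≫ r = 𝟙 _ := by
    rw [← cancel_mono (kernel.ι f)]
    simp [r, Preadditive.comp_sub]
  have : Epi r := epi_of_epi_fac hr
  exact Preadditive.mono_of_kernel_zero
    (hf _ ((torsionClosure S).obj.prop_of_epi r hY) (kernel.condition f))

namespace WideSubcat

instance (W : WideSubcat C) : W.obj.IsClosedUnderIsomorphisms := W.closedUnderIsomorphisms
instance (W : WideSubcat C) : W.obj.ContainsZero := W.containsZero
instance (W : WideSubcat C) : W.obj.IsClosedUnderKernels := W.closedUnderKernels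
instance (W : WideSubcat C) : W.obj.IsClosedUnderCokernels := W.closedUnderCokernels
instance (W : WideSubcat C) : W.obj.IsClosedUnderExtensions := W.closedUnderExtensions

theorem image_mem (W : WideSubcat C) {X Y : C} (f : X ⟶ Y) (hX : W.obj X) (hY : W.obj Y) :
    W.obj (Abelian.image f) :=
  W.obj.prop_kernel _ hY (W.obj.prop_cokernel f hX hY)

theorem image_mem_of_kernel_mem (W : WideSubcat C) {X Y : C} (f : X ⟶ Y) (hX : W.obj X)
    (hK : W.obj (kernel f)) : W.obj (Abelian.image f) :=
  W.obj.prop_of_iso (Abelian.coimageIsoImage f) (W.obj.prop_cokernel _ hK hX)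

variable [IsLengthCategory C] (W : WideSubcat C)

/-- For a nonzero `V ⟶ Y` with `V ∈ W`, the kernel of `V ⟶ X` lies in `W`, so it dies in `Y`. The
image of `V` in `X` therefore embeds in `Y` too, and induction applies after dividing both `Y` and
`X` by it. -/
theorem mono_of_torsionFree_kernel {X : C} (hX : W.obj X) {Y : C} (f : Y ⟶ X)
    (hY : (torsionClosure W.obj).obj Y)
    (hf : ∀ ⦃V : C⦄ (u : V ⟶ Y), W.obj V → u ≫ f = 0 → u = 0) : Mono f := by
  induction hn : objLength Y using Nat.strong_induction_on generalizing X Y with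
  | _ n ih =>
    by_cases h0 : IsZero Y
    · exact ⟨fun _ _ _ => h0.eq_of_tgt _ _⟩
    obtain ⟨V, g, hV, hg⟩ := exists_ne_zero_of_mem_torsionClosure hY h0
    let I := Abelian.image (g ≫ f)
    have hI : W.obj I := W.image_mem _ hV hX
    -- `V ⟶ I` is a quotient through which `g` factors
    have hk : kernel.ι (g ≫ f) ≫ g = 0 :=
      hf _ (W.obj.prop_kernel (g ≫ f) hV hX) (by simp)
    have hmem : W.obj (Abelian.coimage (g ≫ f)) :=
      W.obj.prop_of_iso (Abelian.coimageIsoImage (g ≫ f)).symm hI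
    let i : Abelian.coimage (g ≫ f) ⟶ Y := cokernel.desc _ g hk
    have hi : Abelian.coimage.π (g ≫ f) ≫ i = g := cokernel.π_desc _ _ _
    have hif : i ≫ f = Abelian.factorThruCoimage (g ≫ f) := by
      rw [← cancel_epi (Abelian.coimage.π (g ≫ f)), reassoc_of% hi, Abelian.coimage.fac]
    have hmono : Mono (i ≫ f) := by rw [hif]; infer_instance
    have : Mono i := mono_of_mono i f
    have hine : i ≠ 0 := fun h => hg (by rw [← hi, h, comp_zero])
    let f' : cokernel i ⟶ cokernel (i ≫ f) := cokernel.map i (i ≫ f) (𝟙 _) f (by simp)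
    have hf' : cokernel.π i ≫ f' = f ≫ cokernel.π (i ≫ f) := cokernel.π_desc _ _ _
    have : Mono f' := by
      refine ih _ (hn ▸ objLength_cokernel_lt i hine) (W.obj.prop_cokernel _ hmem hX) f'
        ((torsionClosure W.obj).obj.prop_of_epi (cokernel.π i) hY) (fun V' u hV' hu => ?_) rfl
      have hiker : W.obj (kernel (cokernel.π i)) :=
        W.image_mem_of_kernel_mem i hmem
          (W.obj.prop_of_isZero (isZero_kernel_of_mono i))
      have hP : W.obj (pullback u (cokernel.π i)) :=
        W.obj.prop_of_epi_of_kernel (pullback.fst u (cokernel.π i))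
          ((W.obj.prop_kernel_fst_iff _ _).2 hiker) hV'
      have h1 : (pullback.snd u (cokernel.π i) ≫ f) ≫ cokernel.π (i ≫ f) = 0 := by
        rw [Category.assoc, ← hf', ← Category.assoc, ← pullback.condition, Category.assoc, hu,
          comp_zero]
      obtain ⟨t, ht⟩ : ∃ t, t ≫ i ≫ f = pullback.snd u (cokernel.π i) ≫ f :=
        ⟨_, (ShortComplex.exact_cokernel (i ≫ f)).lift_f _ h1⟩
      -- Both maps from the pullback, an object of `W`, to `Y` agree after `f`, so the hypothesis
      -- kills their difference.
      have h2 : pullback.snd u (cokernel.π i) - t ≫ i = 0 := hf _ hP (by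
        rw [Preadditive.sub_comp, Category.assoc, ht, sub_self])
      rw [← cancel_epi (pullback.fst u (cokernel.π i)), pullback.condition, sub_eq_zero.1 h2,
        Category.assoc, cokernel.condition, comp_zero, comp_zero]
    refine Preadditive.mono_of_cancel_zero _ fun {Z} w hw => ?_
    have h1 : w ≫ cokernel.π i = 0 := by
      rw [← cancel_mono f', Category.assoc, hf', reassoc_of% hw, zero_comp, zero_comp]
    obtain ⟨t, ht⟩ : ∃ t, t ≫ i = w := ⟨_, (ShortComplex.exact_cokernel i).lift_f _ h1⟩
    have h2 : t = 0 := by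
      rw [← cancel_mono (i ≫ f), ← Category.assoc, ht, hw, zero_comp]
    rw [← ht, h2, zero_comp]

theorem le_kernelClosed : W.obj ≤ (torsionClosure W.obj).kernelClosed := fun X hX =>
  kernelClosed_of_mono (le_torsionClosure W.obj X hX) fun _ f hY hf =>
    W.mono_of_torsionFree_kernel hX f hY fun _ u hV =>
      hf u (le_torsionClosure W.obj _ hV)

/-- If `ker p ≠ 0`, it receives a nonzero map from some `V' ∈ W`. The cokernel of `V' ⟶ V` is a
shorter object of `W` over `I`, and its kernel over `I` is a quotient of `ker p`. -/
theorem mem_of_epi_of_kernel_mem {V I : C} (p : V ⟶ I) [Epi p] (hV : W.obj V)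
    (hK : (torsionClosure W.obj).obj (kernel p)) : W.obj I := by
  induction hn : objLength V using Nat.strong_induction_on generalizing V with
  | _ n ih =>
    by_cases h0 : IsZero (kernel p)
    · have : Mono p := Preadditive.mono_of_kernel_zero (h0.eq_of_src _ _)
      have := isIso_of_mono_of_epi p
      exact W.obj.prop_of_iso (asIso p) hV
    obtain ⟨V', g, hV', hg⟩ := exists_ne_zero_of_mem_torsionClosure hK h0
    let h : V' ⟶ V := g ≫ kernel.ι p
    have hne : h ≠ 0 := fun h' => hg (by rw [← cancel_mono (kernel.ι p), zero_comp]; exact h')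
    have hhp : h ≫ p = 0 := by simp [h]
    let p' : cokernel h ⟶ I := cokernel.desc h p hhp
    have hp' : cokernel.π h ≫ p' = p := cokernel.π_desc _ _ _
    have : Epi p' := epi_of_epi_fac hp'
    refine ih _ (hn ▸ objLength_cokernel_lt h hne) p' (W.obj.prop_cokernel h hV' hV) ?_ rfl
    let k : kernel p ⟶ kernel p' := kernel.map p p' (cokernel.π h) (𝟙 I) (by simp [hp'])
    have hk : k ≫ kernel.ι p' = kernel.ι p ≫ cokernel.π h := kernel.lift_ι _ _ _
    have : Epi k := by
      rw [epi_iff_surjective_up_to_refinements]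
      intro A y
      obtain ⟨A', π, hπ, x, hx⟩ :=
        surjective_up_to_refinements_of_epi (cokernel.π h) (y ≫ kernel.ι p')
      refine ⟨A', π, hπ, kernel.lift p x ?_, ?_⟩
      · rw [← hp', ← Category.assoc, ← hx]; simp
      · rw [← cancel_mono (kernel.ι p'), Category.assoc, Category.assoc, hk,
          kernel.lift_ι_assoc, hx]
    exact (torsionClosure W.obj).obj.prop_of_epi k hK

/-- A nonzero `V ⟶ X` with `V ∈ W` has torsion kernel, so its image is in `W`; the cokernel is again
kernel-closed and shorter. -/
theorem kernelClosed_le : (torsionClosure W.obj).kernelClosed ≤ W.obj := by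
  intro X hX
  induction hn : objLength X using Nat.strong_induction_on generalizing X with
  | _ n ih =>
    by_cases h0 : IsZero X
    · exact W.obj.prop_of_isZero h0
    obtain ⟨V, g, hV, hg⟩ := exists_ne_zero_of_mem_torsionClosure hX.1 h0
    have hI : W.obj (Abelian.image g) := by
      refine W.mem_of_epi_of_kernel_mem (Abelian.factorThruImage g) hV ?_
      rw [← (torsionClosure W.obj).obj.prop_kernel_comp_mono_iff _ _
        (Abelian.image.fac g)]
      exact hX.2 g (le_torsionClosure W.obj V hV)
    refine W.obj.prop_of_epi_of_kernel (cokernel.π g) hI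
      (ih _ (hn ▸ objLength_cokernel_lt g hg) _ ?_ rfl)
    exact (torsionClosure W.obj).wide.obj.prop_cokernel g (W.le_kernelClosed V hV) hX

theorem wide_torsionClosure : (torsionClosure W.obj).wide = W :=
  WideSubcat.obj_injective (le_antisymm W.kernelClosed_le W.le_kernelClosed)

end WideSubcat

end Wide

/-! ### Members of canonical join representations -/

section CanonicalJoin

/-- Replacing `a` by `X` in `A` gives another join representation; the antichain condition forces
the element above `a` to come from `X`. -/
theorem IsCanonicalJoinRep.isCompletelyJoinIrred {L : Type*} [CompleteLattice L] {A : Set L}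
    {x : L} (h : IsCanonicalJoinRep A x) {a : L} (ha : a ∈ A) : IsCompletelyJoinIrred a := by
  intro X hX
  have hx : sSup (A \ {a} ∪ X) = x := by
    rw [sSup_union, ← hX, ← h.sSup_eq, sup_comm, ← sSup_insert, Set.insert_sdiff_singleton,
      Set.insert_eq_of_mem ha]
  obtain ⟨b, ⟨hb, hba⟩ | hb, hab⟩ := h.refines _ hx a ha
  · exact absurd (h.antichain a ha b hb hab).symm hba
  · have : b ≤ a := hX ▸ le_sSup hb
    rwa [le_antisymm hab this]

end CanonicalJoin

/-! ### Semibricks, canonical join representations and the core label order -/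

section CoreLabelOrder

variable {C : Type u} [Category.{v} C] [Abelian C]

open TorsionClass

namespace WideSubcat

/-- The simple objects of a wide subcategory. -/
def simples (W : WideSubcat C) : ObjectProperty C := fun B =>
  W.obj B ∧ ¬IsZero B ∧ ∀ ⦃V : C⦄ (i : V ⟶ B) [Mono i], W.obj V → ¬IsZero V → IsIso i

theorem isSemibrick_simples (W : WideSubcat C) : IsSemibrick W.simples := by
  refine ⟨fun X hX => hX.2.1, fun {X Y} f hX hY hf => ?_⟩
  have := hY.2.2 (Abelian.image.ι f) (W.image_mem f hX.1 hY.1) (Abelian.image_not_isZero hf)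
  have : Epi f := by rw [← Abelian.image.fac f]; infer_instance
  have : Mono f := by
    by_contra hm
    have := hX.2.2 (kernel.ι f) (W.obj.prop_kernel f hX.1 hY.1) fun h =>
      hm (Preadditive.mono_of_kernel_zero (h.eq_of_src _ _))
    exact hf (by rw [← cancel_epi (kernel.ι f), kernel.condition, comp_zero])
  exact isIso_of_mono_of_epi f

variable [IsLengthCategory C] (W : WideSubcat C)

theorem exists_mono_of_simples {X : C} (hX : W.obj X) (h0 : ¬IsZero X) :
    ∃ (B : C) (i : B ⟶ X), Mono i ∧ W.simples B := by
  induction hn : objLength X using Nat.strong_induction_on generalizing X with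
  | _ n ih =>
    by_cases hs : W.simples X
    · exact ⟨X, 𝟙 X, inferInstance, hs⟩
    obtain ⟨V, i, _, hV, hV0, hi⟩ : ∃ (V : C) (i : V ⟶ X), Mono i ∧ W.obj V ∧ ¬IsZero V ∧
        ¬IsIso i := by
      by_contra! h
      exact hs ⟨hX, h0, fun V i hi hV hV0 => h V i hi hV hV0⟩
    obtain ⟨B, j, _, hB⟩ := ih _ (hn ▸ objLength_lt_of_mono i hi) hV hV0 rfl
    exact ⟨B, j ≫ i, inferInstance, hB⟩

theorem le_of_simples_le {P : ObjectProperty C} [P.ContainsZero] [P.IsClosedUnderIsomorphisms]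
    [P.IsClosedUnderExtensions] (h : W.simples ≤ P) : W.obj ≤ P := by
  intro X hX
  induction hn : objLength X using Nat.strong_induction_on generalizing X with
  | _ n ih =>
    by_cases h0 : IsZero X
    · exact P.prop_of_isZero h0
    obtain ⟨B, i, _, hB⟩ := W.exists_mono_of_simples hX h0
    have hi : i ≠ 0 := fun h' => hB.2.1 (IsZero.of_mono_eq_zero i h')
    exact P.prop_of_mono_of_cokernel i (h B hB)
      (ih _ (hn ▸ objLength_cokernel_lt i hi) _ (W.obj.prop_cokernel i hB.1 hX) rfl)

theorem torsionClosure_simples : torsionClosure W.simples = torsionClosure W.obj :=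
  le_antisymm (torsionClosure_le.2 fun _ hX => le_torsionClosure _ _ hX.1)
    (torsionClosure_le.2 (W.le_of_simples_le (le_torsionClosure _)))

end WideSubcat

namespace IsSemibrick

variable {S : ObjectProperty C}

/-- For refinement: if no member of `𝒳` contains `B`, all of them lie in `perp B`, and so does their
join, which contains `B`. -/
theorem isCanonicalJoinRep (hS : IsSemibrick S) :
    IsCanonicalJoinRep {T | ∃ B, S B ∧ T = gen B} (torsionClosure S) where
  sSup_eq := by
    apply le_antisymm
    · refine sSup_le ?_
      rintro _ ⟨B, hB, rfl⟩
      exact gen_le.2 (le_torsionClosure S B hB)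
    · exact torsionClosure_le.2 fun B hB => gen_le.1 (le_sSup ⟨B, hB, rfl⟩)
  refines := by
    rintro 𝒳 h𝒳 _ ⟨B, hB, rfl⟩
    by_contra! hn
    have hle : sSup 𝒳 ≤ perp B := by
      refine sSup_le fun T hT => ?_
      by_contra hTB
      exact hn T hT (gen_le.2 (hS.mem_of_not_le_perp hB (h𝒳 ▸ le_sSup hT) hTB))
    rw [h𝒳] at hle
    exact (hS.isBrick hB).not_mem_perp (hle B (le_torsionClosure S B hB))
  antichain := by
    rintro _ ⟨B, hB, rfl⟩ _ ⟨B', hB', rfl⟩ h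
    obtain ⟨X, f, hX, hf⟩ := exists_ne_zero_of_mem_torsionClosure (gen_le.1 h)
      (hS.not_isZero B hB)
    obtain rfl := (ObjectProperty.singleton_iff ..).1 hX
    have := hS.isIso f hB' hB hf
    exact le_antisymm h (gen_le.2 ((gen B).obj.prop_of_iso (asIso f).symm (mem_gen B)))

/-- A larger `T` inside `T(S)` must contain `B`. Any other `B' ∈ S` is either isomorphic to `B` or
already in `perp B`. -/
theorem inf_perp_covBy (hS : IsSemibrick S) {B : C} (hB : S B) :
    torsionClosure S ⊓ perp B ⋖ torsionClosure S := by
  refine ⟨lt_of_le_not_ge inf_le_left fun h => (hS.isBrick hB).not_mem_perp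
    (mem_inf.1 (h B (le_torsionClosure S B hB))).2, fun T hlt hT => hT.not_ge ?_⟩
  have hTB : T.obj B := hS.mem_of_not_le_perp hB hT.le fun h =>
    hlt.not_ge (le_inf hT.le h)
  refine torsionClosure_le.2 fun B' hB' => ?_
  by_cases h : ∀ f : B' ⟶ B, f = 0
  · exact hlt.le B' (mem_inf.2 ⟨le_torsionClosure S B' hB', h⟩)
  · push Not at h
    obtain ⟨f, hf⟩ := h
    have := hS.isIso f hB' hB hf
    exact T.obj.prop_of_iso (asIso f).symm hTB

theorem covBy_iff (hS : IsSemibrick S) {T : TorsionClass C} :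
    T ⋖ torsionClosure S ↔ ∃ B, S B ∧ T = torsionClosure S ⊓ perp B := by
  constructor
  · intro h
    obtain ⟨B, hB, hTB⟩ : ∃ B, S B ∧ ¬T.obj B := by
      by_contra! h'
      exact h.lt.not_ge (torsionClosure_le.2 h')
    refine ⟨B, hB, ?_⟩
    have hle : T ≤ torsionClosure S ⊓ perp B := le_inf h.le <| by
      by_contra hT
      exact hTB (hS.mem_of_not_le_perp hB h.le hT)
    exact hle.eq_or_lt.resolve_right fun hlt => h.2 hlt (hS.inf_perp_covBy hB).lt
  · rintro ⟨B, hB, rfl⟩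
    exact hS.inf_perp_covBy hB

theorem mem_lowerCore (hS : IsSemibrick S) {X : C} :
    (lowerCore (torsionClosure S)).obj X ↔
      (torsionClosure S).obj X ∧ ∀ B, S B → ∀ f : X ⟶ B, f = 0 := by
  rw [lowerCore, mem_inf, mem_sInf]
  refine and_congr_right fun hX => ⟨fun h B hB => ?_, fun h T hT => ?_⟩
  · exact (mem_inf.1 (h _ (hS.inf_perp_covBy hB))).2
  · obtain ⟨B, hB, rfl⟩ := hS.covBy_iff.1 hT
    exact mem_inf.2 ⟨hX, h B hB⟩

end IsSemibrick

/-- Forwards, `Y` is filtered by simples of `W`, to which `T(W)_↓` has no nonzero maps. Backwards, a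
nonzero `Y` is not in `T(W)_↓`, so it maps onto a simple of `W`; the kernel is torsion by
`le_kernelClosed` and inherits the hypotheses. -/
theorem WideSubcat.mem_iff_lowerCore_le_perp [IsLengthCategory C] (W : WideSubcat C) {Y : C} :
    W.obj Y ↔ (torsionClosure W.obj).obj Y ∧ lowerCore (torsionClosure W.obj) ≤ perp Y := by
  have hS := W.isSemibrick_simples
  constructor
  · refine fun hY => ⟨le_torsionClosure _ _ hY, fun X hX => ?_⟩
    rw [← W.torsionClosure_simples, hS.mem_lowerCore] at hX
    induction hn : objLength Y using Nat.strong_induction_on generalizing Y with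
    | _ n ih =>
      intro f
      by_cases h0 : IsZero Y
      · exact h0.eq_of_tgt _ _
      obtain ⟨B, i, _, hB⟩ := W.exists_mono_of_simples hY h0
      have hi : i ≠ 0 := fun h' => hB.2.1 (IsZero.of_mono_eq_zero i h')
      have hf := ih _ (hn ▸ objLength_cokernel_lt i hi) (W.obj.prop_cokernel i hB.1 hY) rfl
        (f ≫ cokernel.π i)
      have hl := (ShortComplex.exact_cokernel i).lift_f f hf
      rw [hX.2 B hB ((ShortComplex.exact_cokernel i).lift f hf), zero_comp] at hl
      exact hl.symm
  · rintro ⟨hY, hc⟩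
    induction hn : objLength Y using Nat.strong_induction_on generalizing Y with
    | _ n ih =>
      by_cases h0 : IsZero Y
      · exact W.obj.prop_of_isZero h0
      obtain ⟨B, f, hB, hf⟩ : ∃ (B : C) (f : Y ⟶ B), W.simples B ∧ f ≠ 0 := by
        by_contra! h
        refine h0 ((IsZero.iff_id_eq_zero Y).2 (hc Y ?_ (𝟙 Y)))
        rw [← W.torsionClosure_simples, hS.mem_lowerCore, W.torsionClosure_simples]
        exact ⟨hY, fun B hB f => h B f hB⟩
      have : Epi f := by
        rw [← W.torsionClosure_simples] at hY
        exact hS.epi_of_ne_zero hY hB f hf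
      refine W.obj.prop_of_epi_of_kernel f (ih _ (hn ▸ objLength_kernel_lt f hf)
        ((W.le_kernelClosed B hB.1).2 f hY) (fun X hX g => ?_) rfl) hB.1
      rw [← cancel_mono (kernel.ι f), zero_comp]
      exact hc X hX _

/-- Distinct members of a canonical join representation by bricks are Hom-orthogonal. -/
theorem IsCanonicalJoinRep.hom_eq_zero {A : Set (TorsionClass C)} {x : TorsionClass C}
    (h : IsCanonicalJoinRep A x) {B B' : C} (hB' : IsBrick B') (hA : gen B ∈ A)
    (hA' : gen B' ∈ A) (hne : gen B ≠ gen B') (f : B ⟶ B') : f = 0 := by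
  by_contra hf
  -- With `gen B'` replaced by its lower star, the map `f` from `B` still forces `B'` into the join.
  -- The join is unchanged, yet no member lies above `gen B'`.
  have hmem : (sSup (insert (lowerStar (gen B')) (A \ {gen B'}))).obj B' :=
    hB'.mem_of_lowerStar_le (le_sSup (Set.mem_insert _ _))
      (le_sSup (Set.mem_insert_of_mem _ ⟨hA, hne⟩)) (not_le_perp (mem_gen B) hf)
  have hx : sSup (insert (lowerStar (gen B')) (A \ {gen B'})) = x := by
    rw [← h.sSup_eq]
    apply le_antisymm
    · refine sSup_le ?_
      rintro T (rfl | hT)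
      · exact (sSup_le fun _ hT => le_of_lt hT).trans (le_sSup hA')
      · exact le_sSup hT.1
    · refine sSup_le fun T hT => ?_
      by_cases hTB : T = gen B'
      · rw [hTB]; exact gen_le.2 hmem
      · exact le_sSup (Set.mem_insert_of_mem _ ⟨hT, hTB⟩)
  obtain ⟨T, rfl | ⟨hT, hTB⟩, hle⟩ := h.refines _ hx _ hA'
  · exact ((hB'.lt_gen_iff.2 hB'.lowerStar_gen.le).not_ge hle).elim
  · exact hTB (h.antichain _ hA' _ hT hle).symm

variable [IsLengthCategory C]

theorem IsBrick.gen_mem_jlabel_iff (W : WideSubcat C) {B : C} (hB : IsBrick B) :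
    gen B ∈ jlabel (lowerCore (torsionClosure W.obj)) (torsionClosure W.obj) ↔ W.obj B := by
  rw [W.mem_iff_lowerCore_le_perp, ← gen_le, ← hB.kappa_gen]
  exact and_iff_right hB.isCompletelyJoinIrred_gen

theorem WideSubcat.le_iff_jlabel_subset (W₁ W₂ : WideSubcat C) :
    W₁ ≤ W₂ ↔ jlabel (lowerCore (torsionClosure W₁.obj)) (torsionClosure W₁.obj) ⊆
      jlabel (lowerCore (torsionClosure W₂.obj)) (torsionClosure W₂.obj) := by
  constructor
  · intro h j hj
    obtain ⟨B, hB, rfl⟩ := hj.1.exists_brick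
    rw [hB.gen_mem_jlabel_iff] at hj ⊢
    exact h B hj
  · intro h
    refine W₁.le_of_simples_le fun B hB => ?_
    have hb := W₁.isSemibrick_simples.isBrick hB
    exact (hb.gen_mem_jlabel_iff W₂).1 (h ((hb.gen_mem_jlabel_iff W₁).2 hB.1))

theorem IsCanonicalJoinRep.exists_semibrick {A : Set (TorsionClass C)} {x : TorsionClass C}
    (h : IsCanonicalJoinRep A x) :
    ∃ S : ObjectProperty C, IsSemibrick S ∧ torsionClosure S = x := by
  -- `choose!` needs a default object for arguments outside `A`.
  obtain ⟨Z, -⟩ := HasZeroObject.zero (C := C)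
  have : Nonempty C := ⟨Z⟩
  choose! b hb hab using fun a (ha : a ∈ A) => (h.isCompletelyJoinIrred ha).exists_brick
  refine ⟨fun X => ∃ a ∈ A, X = b a, ⟨?_, ?_⟩, ?_⟩
  · rintro _ ⟨a, ha, rfl⟩
    exact (hb a ha).not_isZero
  · rintro _ _ f ⟨a, ha, rfl⟩ ⟨a', ha', rfl⟩ hf
    by_cases haa : a = a'
    · subst haa
      exact (hb a ha).isIso f hf
    · rw [hab a ha, hab a' ha'] at haa
      exact absurd (h.hom_eq_zero (hb a' ha') (hab a ha ▸ ha) (hab a' ha' ▸ ha') haa f) hf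
  · rw [← h.sSup_eq]
    apply le_antisymm
    · refine torsionClosure_le.2 ?_
      rintro _ ⟨a, ha, rfl⟩
      exact gen_le.1 ((hab a ha).symm.le.trans (le_sSup ha))
    · refine sSup_le fun a ha => (hab a ha).le.trans (gen_le.2 ?_)
      exact le_torsionClosure _ (b a) ⟨a, ha, rfl⟩

theorem IsSemibrick.torsionClosure_wide {S : ObjectProperty C} (hS : IsSemibrick S) :
    torsionClosure (torsionClosure S).wide.obj = torsionClosure S :=
  le_antisymm (torsionClosure_le.2 (torsionClosure S).kernelClosed_le)
    (torsionClosure_le.2 fun B hB => le_torsionClosure _ B (hS.le_kernelClosed B hB))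

/-- The torsion class generated by a wide subcategory, as an element of the core label order. -/
def WideSubcat.toCJRElements (W : WideSubcat C) : CJRElements (TorsionClass C) :=
  ⟨torsionClosure W.obj, _, W.torsionClosure_simples ▸ W.isSemibrick_simples.isCanonicalJoinRep⟩

theorem WideSubcat.toCJRElements_bijective :
    Function.Bijective (WideSubcat.toCJRElements : WideSubcat C → CJRElements (TorsionClass C)) := by
  constructor
  · intro W₁ W₂ h
    rw [← W₁.wide_torsionClosure, ← W₂.wide_torsionClosure]
    exact congrArg TorsionClass.wide (congrArg Subtype.val h)
  · rintro ⟨x, A, hA⟩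
    obtain ⟨S, hS, rfl⟩ := hA.exists_semibrick
    exact ⟨(torsionClosure S).wide, Subtype.ext hS.torsionClosure_wide⟩

end CoreLabelOrder

theorem theorem4 {C : Type u} [Category.{v} C] [Abelian C]
    (hlength : ∀ X : C, HasCompositionSeries X) :
    (∀ j : TorsionClass C, IsCompletelyJoinIrred j →
      IsGreatest {x : TorsionClass C | j ⊓ x = lowerStar j} (kappa j)) ∧
    ∃ e : ((· ≤ ·) : WideSubcat C → WideSubcat C → Prop) ≃r
        (cloLE : CJRElements (TorsionClass C) → CJRElements (TorsionClass C) → Prop),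
      ∀ W : WideSubcat C, (e W).1 = torsionClosure W.obj := by
  have : IsLengthCategory C := ⟨hlength⟩
  refine ⟨fun j hj => ?_, ⟨Equiv.ofBijective _ WideSubcat.toCJRElements_bijective,
    fun {W₁ W₂} => (W₁.le_iff_jlabel_subset W₂).symm⟩, fun W => rfl⟩
  obtain ⟨B, hB, rfl⟩ := hj.exists_brick
  rw [hB.kappa_gen]
  exact hB.isGreatest_perp
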